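/- Let $m,n\ge 0$ and $n_1,\dots,n_n\ge 0$ be integers, let $b\in\mathbb{R}^m$, let $A_i\in\mathbb{R}^{m\times n_i}$ and let $f_i:\mathbb{R}^{n_i}\to[-\infty,+\infty]$ $(i=1,\dots,n)$ be proper (that is, $f_i$ never takes the value $-\infty$ and its domain $\operatorname{dom} f_i=\{x: f_i(x)<+\infty\}$ is nonempty) and lower semicontinuous, with $\operatorname{dom} f_i$ bounded. Let $$p=\inf\Big\{\sum_{i=1}^n f_i(x^i)\;:\;x^i\in\mathbb{R}^{n_i},\ \sum_{i=1}^n A_ix^i\le b\Big\},\qquad d=\sup_{y\in\mathbb{R}^m,\ y\ge 0}\Big\{-\sum_{i=1}^n f_i^*(-A_i^Ty)-b^Ty\Big\}$$ be the optimal values of the primal problem and of its dual, where vector inequalities are componentwise and $f_i^*(u)=\sup_x\{u^Tx-f_i(x)\}$ is the conjugate of $f_i$. For an integer $k\ge 1$ let $$\rho^k(f_i)=\sup\Big\{f_i\Big(\sum_{j=1}^k\alpha_jx^j\Big)-\sum_{j=1}^k\alpha_jf_i(x^j)\;:\;x^j\in\operatorname{dom} f_i,\ \alpha_j\ge 0,\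 \sum_{j=1}^k\alpha_j=1\Big\}\in[0,+\infty]$$ be the $k$th nonconvexity of $f_i$. Assume that the primal problem is feasible, i.e. $p<+\infty$. Then $p$ and $d$ are finite, and there exist integers $1\le k_i\le m+1$ $(i=1,\dots,n)$ with $\sum_{i=1}^n k_i\le m+n$ such that the duality gap satisfies $$p-d\le\sum_{i=1}^n\rho^{k_i}(f_i).$$ -/

import Mathlib

open scoped Matrix

namespace SeparableDuality

/-- The effective domain `{x | f x < +∞}` of an extended-real-valued function. -/
def dom {E : Type*} (f : E → EReal) : Set E := {x | f x < ⊤}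

/-- A proper function: it never takes the value `-∞` and its domain is nonempty. -/
def IsProper {E : Type*} (f : E → EReal) : Prop :=
  (∀ x, f x ≠ ⊥) ∧ (dom f).Nonempty

/-- The `k`-th nonconvexity of `f`: the supremum in `[-∞, +∞]` of
`f (∑ j, α j • x j) - ∑ j, α j * f (x j)` over all convex combinations of `k`
(not necessarily distinct) points of the domain of `f`. -/
noncomputable def nonconvexity {E : Type*} [AddCommGroup E] [Module ℝ E]
    (k : ℕ) (f : E → EReal) : EReal :=
  sSup {r : EReal | ∃ (α : Fin k → ℝ) (x : Fin k → E),
    (∀ j, 0 ≤ α j) ∧ ∑ j, α j = 1 ∧ (∀ j, x j ∈ dom f) ∧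
      r = f (∑ j, α j • x j) - ∑ j, (α j : EReal) * f (x j)}

/-- The conjugate function `f* (y) = sup_x (yᵀ x - f x)`. -/
noncomputable def conjugate {N : ℕ} (f : (Fin N → ℝ) → EReal) (y : Fin N → ℝ) : EReal :=
  ⨆ x : Fin N → ℝ, (((y ⬝ᵥ x : ℝ) : EReal) - f x)

/-- The optimal value of: minimize `∑ i, f i (x i)` subject to `∑ i, A i *ᵥ x i ≤ b`
(componentwise). It is `+∞` exactly when no `x` that satisfies the constraint has a
finite objective value (for functions that never take the value `-∞`). -/
noncomputable def primalValue {m n : ℕ} {N : Fin n → ℕ}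
    (f : (i : Fin n) → (Fin (N i) → ℝ) → EReal)
    (A : (i : Fin n) → Matrix (Fin m) (Fin (N i)) ℝ) (b : Fin m → ℝ) : EReal :=
  ⨅ x ∈ {x : (i : Fin n) → Fin (N i) → ℝ | ∑ i, A i *ᵥ x i ≤ b}, ∑ i, f i (x i)

/-- The optimal value of the dual problem: maximize `-∑ i, (f i)* (-(A i)ᵀ y) - bᵀ y`
subject to `0 ≤ y` (componentwise). -/
noncomputable def dualValue {m n : ℕ} {N : Fin n → ℕ}
    (f : (i : Fin n) → (Fin (N i) → ℝ) → EReal)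
    (A : (i : Fin n) → Matrix (Fin m) (Fin (N i)) ℝ) (b : Fin m → ℝ) : EReal :=
  ⨆ y ∈ {y : Fin m → ℝ | 0 ≤ y},
    (-(∑ i, conjugate (f i) (-((A i)ᵀ *ᵥ y))) - ((b ⬝ᵥ y : ℝ) : EReal))

end SeparableDuality

namespace SeparableDuality

/-! The dual value is the value of the convexified problem, up to closure. Let `H` be the Minkowski
sum of the convex hulls of the graphs of `(A i *ᵥ x, f i x)` over the domains. If `(b, d)` lay
outside the closure of `H` plus the nonnegative orthant, a separating hyperplane would give a
multiplier with dual value above `d`. Hence for every `ε > 0` some point of `H` lies below `(b + ε,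
d + ε)` (`exists_mem_sum_convexHull_le`).

Such a point is a system of convex combinations, one per block. Its weights solve a linear program
with `m + n` equality constraints: `m` for the coupling, `n` for the weight sums. The cost is the
objective, not a constraint, so a sparse solution has at most `m + n` nonzero weights. This is the
Shapley–Folkman argument; replacing each combination by its barycentre costs at most the
nonconvexities (`exists_of_mem_sum_convexHull`).

Compactness and lower semicontinuity then let `ε` tend to `0` (`primalValue_le_of_forall_pos`). -/

/-! ### Sparse solutions of linear programs -/

open Finset in
/-- Moving nonnegative weights along a linear dependency of the vectors in their support kills
one of the weights without increasing a linear cost. -/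
lemma exists_weights_support_card_lt {ι V : Type*} [Fintype ι] [AddCommGroup V] [Module ℝ V]
    [FiniteDimensional ℝ V] (v : ι → V) (φ : V →ₗ[ℝ] ℝ) (hφ : ∀ j, 0 < φ (v j)) (c : ι → ℝ)
    (w : ι → ℝ) (hw : ∀ j, 0 ≤ w j) (hcard : Module.finrank ℝ V < #{j | w j ≠ 0}) :
    ∃ w' : ι → ℝ, (∀ j, 0 ≤ w' j) ∧ ∑ j, w' j • v j = ∑ j, w j • v j ∧
      ∑ j, w' j * c j ≤ ∑ j, w j * c j ∧ #{j | w' j ≠ 0} < #{j | w j ≠ 0} := by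
  classical
  set s : Finset ι := {j | w j ≠ 0} with hs
  have hdep : ¬ LinearIndepOn ℝ v (s : Set ι) := fun h => by
    have := LinearIndependent.fintype_card_le_finrank h
    simp only [SetLike.coe_sort_coe, Fintype.card_coe] at this
    omega
  rw [linearIndepOn_finset_iff] at hdep
  push Not at hdep
  obtain ⟨g, hg, j₀, hj₀, hgj₀⟩ := hdep
  -- Either the dependency or its negative does not increase the cost.
  obtain ⟨l, hl, hlc, hl0, hls⟩ : ∃ l : ι → ℝ, ∑ j, l j • v j = 0 ∧ ∑ j, l j * c j ≤ 0 ∧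
      (∃ j, l j ≠ 0) ∧ ∀ j, w j = 0 → l j = 0 := by
    have h1 : ∑ j, (if j ∈ s then g j else 0) • v j = 0 := by
      simpa [ite_smul, Finset.sum_ite_mem] using hg
    have h2 : ∀ j, w j = 0 → (if j ∈ s then g j else 0) = 0 := fun j hj => by simp [hs, hj]
    rcases le_total (∑ j, (if j ∈ s then g j else 0) * c j) 0 with h | h
    · exact ⟨_, h1, h, ⟨j₀, by simpa [hj₀] using hgj₀⟩, h2⟩
    · refine ⟨fun j => -(if j ∈ s then g j else 0), ?_, ?_, ⟨j₀, by simpa [hj₀] using hgj₀⟩, ?_⟩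
      · simp only [neg_smul, Finset.sum_neg_distrib, h1, neg_zero]
      · simpa only [neg_mul, Finset.sum_neg_distrib, neg_nonpos] using h
      · exact fun j hj => neg_eq_zero.2 (h2 j hj)
  -- Applying `φ` to the dependency gives a zero sum with positive coefficients `φ (v j)`, so a
  -- nonzero `l` cannot be nonnegative.
  have hneg : ∃ j, l j < 0 := by
    by_contra! hcon
    have h0 : ∑ j, l j * φ (v j) = 0 := by
      have := congrArg φ hl
      simpa [map_sum] using this
    rw [Finset.sum_eq_zero_iff_of_nonneg fun j _ => mul_nonneg (hcon j) (hφ j).le] at h0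
    obtain ⟨j, hj⟩ := hl0
    exact (mul_ne_zero hj (hφ j).ne') (h0 j (mem_univ j))
  -- Ratio test: the least ratio is the longest step along `l` that keeps all weights nonnegative,
  -- and it annihilates the weight at `j₁`.
  obtain ⟨j₁, hj₁, hmin⟩ := Finset.exists_min_image ({j | l j < 0} : Finset ι)
    (fun j => w j / -l j) (by obtain ⟨j, hj⟩ := hneg; exact ⟨j, by simpa using hj⟩)
  simp only [mem_filter, mem_univ, true_and] at hj₁ hmin
  set t := w j₁ / -l j₁ with ht
  have ht0 : 0 ≤ t := div_nonneg (hw _) (by linarith)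
  have hz : w j₁ + t * l j₁ = 0 := by
    rw [ht, div_mul_eq_mul_div, div_neg, mul_div_cancel_right₀ _ hj₁.ne]; ring
  refine ⟨fun j => w j + t * l j, fun j => ?_, ?_, ?_, ?_⟩
  · rcases lt_or_ge (l j) 0 with h | h
    · have := hmin j h
      rw [le_div_iff₀ (by linarith)] at this
      linarith
    · exact add_nonneg (hw j) (mul_nonneg ht0 h)
  · simp only [add_smul, mul_smul, Finset.sum_add_distrib, ← Finset.smul_sum, hl, smul_zero,
      add_zero]
  · simp only [add_mul, mul_assoc, Finset.sum_add_distrib, ← Finset.mul_sum]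
    nlinarith
  · refine Finset.card_lt_card (Finset.ssubset_iff_of_subset ?_ |>.2 ⟨j₁, ?_, ?_⟩)
    · intro j hj
      simp only [mem_filter, mem_univ, true_and, hs] at hj ⊢
      exact fun h => hj (by rw [h, hls j h]; simp)
    · simp only [hs, mem_filter, mem_univ, true_and]
      exact fun h => hj₁.ne (hls _ h)
    · simp [hz]

open Finset in
/-- A linear program in standard form has, below any feasible point, a feasible point whose
support has at most as many elements as there are equality constraints. -/
lemma exists_weights_support_card_le {ι V : Type*} [Fintype ι] [AddCommGroup V] [Module ℝ V]
    [FiniteDimensional ℝ V] (v : ι → V) (φ : V →ₗ[ℝ] ℝ) (hφ : ∀ j, 0 < φ (v j)) (c : ι → ℝ)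
    (w : ι → ℝ) (hw : ∀ j, 0 ≤ w j) :
    ∃ w' : ι → ℝ, (∀ j, 0 ≤ w' j) ∧ ∑ j, w' j • v j = ∑ j, w j • v j ∧
      ∑ j, w' j * c j ≤ ∑ j, w j * c j ∧ #{j | w' j ≠ 0} ≤ Module.finrank ℝ V := by
  induction hN : #{j | w j ≠ 0} using Nat.strong_induction_on generalizing w with
  | _ N ih =>
    by_cases hle : #{j | w j ≠ 0} ≤ Module.finrank ℝ V
    · exact ⟨w, hw, rfl, le_rfl, hle⟩
    · obtain ⟨w₁, h1, h2, h3, h4⟩ :=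
        exists_weights_support_card_lt v φ hφ c w hw (not_le.1 hle)
      obtain ⟨w₂, g1, g2, g3, g4⟩ := ih _ (hN ▸ h4) w₁ h1 rfl
      exact ⟨w₂, g1, g2.trans h2, g3.trans h3, g4⟩

/-! ### Extended-real sums, lower bounds and conjugates -/

lemma coe_sum_eq {ι : Type*} (s : Finset ι) (g : ι → ℝ) :
    ((∑ i ∈ s, g i : ℝ) : EReal) = ∑ i ∈ s, (g i : EReal) :=
  map_sum (⟨⟨Real.toEReal, EReal.coe_zero⟩, EReal.coe_add⟩ : ℝ →+ EReal) g s

lemma sum_ne_bot {ι : Type*} {s : Finset ι} {g : ι → EReal} (h : ∀ i ∈ s, g i ≠ ⊥) :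
    ∑ i ∈ s, g i ≠ ⊥ :=
  Finset.sum_induction g (· ≠ ⊥) (fun _ _ ha hb => by simp [EReal.add_eq_bot_iff, ha, hb])
    EReal.zero_ne_bot h

lemma lt_top_of_sum_lt_top {ι : Type*} [Fintype ι] {g : ι → EReal} (h : ∀ i, g i ≠ ⊥)
    (hs : ∑ i, g i < ⊤) (i : ι) : g i < ⊤ := by
  classical
  by_contra hi
  rw [not_lt_top_iff] at hi
  rw [← Finset.add_sum_erase _ _ (Finset.mem_univ i), hi,
    EReal.top_add_of_ne_bot (sum_ne_bot fun j _ => h j)] at hs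
  exact lt_irrefl _ hs

/-- Excluding `⊥` matters: addition on `EReal` is not continuous at `(⊤, ⊥)`. -/
lemma lowerSemicontinuous_finset_sum {X ι : Type*} [TopologicalSpace X] {g : ι → X → EReal}
    (hbot : ∀ i x, g i x ≠ ⊥) (hg : ∀ i, LowerSemicontinuous (g i)) (s : Finset ι) :
    LowerSemicontinuous fun x => ∑ i ∈ s, g i x := by
  classical
  induction s using Finset.induction_on with
  | empty => simpa using lowerSemicontinuous_const
  | insert a s ha ih =>
    simp only [Finset.sum_insert ha]
    exact (hg a).add' ih fun x => EReal.continuousAt_add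
      (Or.inr (sum_ne_bot fun i _ => hbot i x)) (Or.inl (hbot a x))

lemma coe_toReal_of_mem_dom {E : Type*} {f : E → EReal} (hf : IsProper f) {x : E}
    (hx : x ∈ dom f) : ((f x).toReal : EReal) = f x :=
  EReal.coe_toReal (ne_of_lt hx) (hf.1 x)

/-- A proper lower semicontinuous function with bounded domain is bounded below. -/
lemma exists_real_le {N : ℕ} {f : (Fin N → ℝ) → EReal} (hf : IsProper f)
    (hlsc : LowerSemicontinuous f) (hbdd : Bornology.IsBounded (dom f)) :
    ∃ l : ℝ, ∀ x, (l : EReal) ≤ f x := by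
  obtain ⟨a, -, ha⟩ := (hlsc.lowerSemicontinuousOn (closure (dom f))).exists_isMinOn
    hf.2.closure hbdd.isCompact_closure
  obtain ⟨x₀, hx₀⟩ := hf.2
  have hafin : a ∈ dom f := lt_of_le_of_lt (isMinOn_iff.1 ha _ (subset_closure hx₀)) (show f x₀ < ⊤ from hx₀)
  refine ⟨(f a).toReal, fun x => ?_⟩
  rw [coe_toReal_of_mem_dom hf hafin]
  by_cases hx : x ∈ dom f
  · exact ha (subset_closure hx)
  · exact (not_lt_top_iff.1 (show ¬ f x < ⊤ from hx)).symm ▸ le_top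

/-- On the bounded domain the linear term is bounded above and `f` is bounded below, so the
conjugate is finite everywhere. The real least upper bound allows near-maximizers to be chosen
inside the domain. -/
lemma exists_conjugate_eq_isLUB {N : ℕ} {f : (Fin N → ℝ) → EReal} (hf : IsProper f)
    (hlsc : LowerSemicontinuous f) (hbdd : Bornology.IsBounded (dom f)) (u : Fin N → ℝ) :
    ∃ q : ℝ, conjugate f u = q ∧ IsLUB ((fun x => u ⬝ᵥ x - (f x).toReal) '' dom f) q := by
  obtain ⟨l, hl⟩ := exists_real_le hf hlsc hbdd
  have hcont : Continuous fun x : Fin N → ℝ => u ⬝ᵥ x := by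
    unfold dotProduct; fun_prop
  obtain ⟨B, hB⟩ := (hbdd.isCompact_closure.image hcont).bddAbove
  have hbddAbove : BddAbove ((fun x => u ⬝ᵥ x - (f x).toReal) '' dom f) := by
    refine ⟨B - l, ?_⟩
    rintro _ ⟨x, hx, rfl⟩
    have h1 : u ⬝ᵥ x ≤ B := hB ⟨x, subset_closure hx, rfl⟩
    have h2 : l ≤ (f x).toReal := by
      have := hl x
      rwa [← coe_toReal_of_mem_dom hf hx, EReal.coe_le_coe_iff] at this
    simp only
    linarith
  obtain ⟨q, hq⟩ := Real.exists_isLUB (hf.2.image _) hbddAbove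
  refine ⟨q, le_antisymm (iSup_le fun x => ?_) ?_, hq⟩
  · by_cases hx : x ∈ dom f
    · rw [← coe_toReal_of_mem_dom hf hx, ← EReal.coe_sub, EReal.coe_le_coe_iff]
      exact hq.1 ⟨x, hx, rfl⟩
    · rw [not_lt_top_iff.1 (show ¬ f x < ⊤ from hx), EReal.sub_top]
      exact bot_le
  · refine EReal.le_of_forall_lt_iff_le.1 fun r hr => ?_
    have hub : r ∈ upperBounds ((fun x => u ⬝ᵥ x - (f x).toReal) '' dom f) := by
      rintro _ ⟨x, hx, rfl⟩
      rw [← EReal.coe_le_coe_iff, EReal.coe_sub, coe_toReal_of_mem_dom hf hx]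
      exact (le_iSup (fun x : Fin N → ℝ => ((u ⬝ᵥ x : ℝ) : EReal) - f x) x).trans hr.le
    exact EReal.coe_le_coe_iff.2 (hq.2 hub)

/-! ### Shapley–Folkman reduction -/

lemma sum_equivFin_symm {ι M : Type*} [AddCommMonoid M] (s : Finset ι) (g : ι → M) :
    ∑ a : Fin s.card, g (s.equivFin.symm a) = ∑ j ∈ s, g j := by
  rw [← Finset.sum_coe_sort s g]
  exact Equiv.sum_comp s.equivFin.symm fun j : s => g j

/-- The average of the values is a real number, so it can be moved across the inequality even when
`f` is `⊤` at the barycentre. -/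
lemma le_nonconvexity_add {E ι : Type*} [AddCommGroup E] [Module ℝ E] {f : E → EReal}
    (hf : IsProper f) (s : Finset ι) (w : ι → ℝ) (x : ι → E) (hw : ∀ j ∈ s, 0 ≤ w j)
    (hw1 : ∑ j ∈ s, w j = 1) (hx : ∀ j ∈ s, x j ∈ dom f) :
    f (∑ j ∈ s, w j • x j) ≤
      nonconvexity s.card f + ((∑ j ∈ s, w j * (f (x j)).toReal : ℝ) : EReal) := by
  refine (EReal.sub_le_iff_le_add (.inl (EReal.coe_ne_bot _)) (.inl (EReal.coe_ne_top _))).1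
    (le_sSup ⟨fun a => w (s.equivFin.symm a), fun a => x (s.equivFin.symm a),
      fun a => hw _ (s.equivFin.symm a).2, (sum_equivFin_symm s w).trans hw1,
      fun a => hx _ (s.equivFin.symm a).2, ?_⟩)
  rw [sum_equivFin_symm s fun j => w j • x j,
    sum_equivFin_symm s fun j => (w j : EReal) * f (x j), coe_sum_eq]
  congr 1
  refine Finset.sum_congr rfl fun j hj => ?_
  rw [EReal.coe_mul, coe_toReal_of_mem_dom hf (hx j hj)]

open Pointwise in
open Finset in
/-- Every point of the sum of the convexified graphs is realized, up to the nonconvexities of the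
functions, by convex combinations that use at most `m + n` points altogether. -/
lemma exists_of_mem_sum_convexHull {m n : ℕ} {N : Fin n → ℕ}
    {f : (i : Fin n) → (Fin (N i) → ℝ) → EReal} (hproper : ∀ i, IsProper (f i))
    (A : (i : Fin n) → Matrix (Fin m) (Fin (N i)) ℝ) {z : (Fin m → ℝ) × ℝ}
    (hz : z ∈ ∑ i, convexHull ℝ ((fun x => (A i *ᵥ x, (f i x).toReal)) '' dom (f i))) :
    ∃ k : Fin n → ℕ, (∀ i, 1 ≤ k i ∧ k i ≤ m + 1) ∧ ∑ i, k i ≤ m + n ∧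
      ∃ x : (i : Fin n) → Fin (N i) → ℝ, (∀ i, x i ∈ convexHull ℝ (dom (f i))) ∧
        ∑ i, A i *ᵥ x i = z.1 ∧
        ∑ i, f i (x i) ≤ ∑ i, nonconvexity (k i) (f i) + ((z.2 : ℝ) : EReal) := by
  classical
  obtain ⟨p, hp, rfl⟩ := (Set.mem_fintype_sum _ _).1 hz
  choose J hJ w y hw hw1 hy hp using fun i => mem_convexHull_iff_exists_fintype.1 (hp i)
  choose x hx hxy using hy
  -- The unit vector records the block, so preserving the weighted sum of `v` also preserves the
  -- total weight of each block. The ambient dimension is `m + n`.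
  let v : (Σ i, J i) → (Fin m → ℝ) × (Fin n → ℝ) :=
    fun j => (A j.1 *ᵥ x j.1 j.2, Pi.single j.1 1)
  let φ : (Fin m → ℝ) × (Fin n → ℝ) →ₗ[ℝ] ℝ :=
    (∑ i, LinearMap.proj i) ∘ₗ LinearMap.snd ℝ (Fin m → ℝ) (Fin n → ℝ)
  have hφ : ∀ j, 0 < φ (v j) := fun j => by simp [φ, v]
  obtain ⟨w', h0, hv, hc, hcard⟩ := exists_weights_support_card_le v φ hφ
    (fun j => (f j.1 (x j.1 j.2)).toReal) (fun j => w j.1 j.2) (fun j => hw j.1 j.2)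
  have hfst := congrArg Prod.fst hv
  have hsnd := congrArg Prod.snd hv
  simp only [v, Prod.fst_sum, Prod.snd_sum, Prod.smul_fst, Prod.smul_snd, Fintype.sum_sigma]
    at hfst hsnd hc
  have hblock : ∀ i, ∑ j, w' ⟨i, j⟩ = 1 := fun i => by
    have h := congrFun hsnd i
    simp only [Finset.sum_apply, Pi.smul_apply, smul_eq_mul, ← Finset.sum_mul, hw1] at h
    simp only [Pi.single_apply, mul_ite, mul_one, mul_zero, Finset.sum_ite_eq, Finset.mem_univ,
      if_true] at h
    exact h
  let s : (i : Fin n) → Finset (J i) := fun i => {j | w' ⟨i, j⟩ ≠ 0}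
  have hs : ∀ {M : Type} [AddCommMonoid M] [Module ℝ M] (i : Fin n) (g : J i → M),
      ∑ j ∈ s i, w' ⟨i, j⟩ • g j = ∑ j, w' ⟨i, j⟩ • g j := fun i g =>
    Finset.sum_subset (Finset.subset_univ _) fun j _ hj => by
      have : w' ⟨i, j⟩ = 0 := by simpa [s] using hj
      rw [this, zero_smul]
  have hs1 : ∀ i, ∑ j ∈ s i, w' ⟨i, j⟩ = 1 := fun i => by
    simpa [hblock] using hs i fun _ => (1 : ℝ)
  have hk1 : ∀ i, 1 ≤ (s i).card := fun i => by
    rw [Nat.one_le_iff_ne_zero, Finset.card_ne_zero]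
    by_contra h
    have := hs1 i
    simp [Finset.not_nonempty_iff_eq_empty.1 h] at this
  have hksum : ∑ i, (s i).card ≤ m + n := by
    have h1 : (univ.sigma s) = ({j | w' j ≠ 0} : Finset (Σ i, J i)) := by
      ext ⟨i, j⟩; simp [s]
    rw [← Finset.card_sigma, h1]
    simpa using hcard
  refine ⟨fun i => (s i).card, fun i => ⟨hk1 i, ?_⟩, hksum,
    fun i => ∑ j ∈ s i, w' ⟨i, j⟩ • x i j, fun i => ?_, ?_, ?_⟩
  -- Each of the other `n - 1` blocks uses at least one point, which leaves at most `m + 1` for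
  -- block `i`.
  · have h1 := Finset.add_sum_erase univ (fun i => (s i).card) (Finset.mem_univ i)
    have h2 : (univ.erase i).card • 1 ≤ ∑ i' ∈ univ.erase i, (s i').card :=
      Finset.card_nsmul_le_sum _ _ _ fun i' _ => hk1 i'
    rw [Finset.card_erase_of_mem (Finset.mem_univ i), Finset.card_univ, Fintype.card_fin] at h2
    have := i.pos
    simp only [smul_eq_mul] at h1 h2 ⊢
    omega
  · exact (convex_convexHull ℝ _).sum_mem (fun j _ => h0 _) (hs1 i)
      fun j _ => subset_convexHull ℝ _ (hx i j)
  · rw [Prod.fst_sum]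
    simp only [hs, Matrix.mulVec_sum, Matrix.mulVec_smul, hfst]
    refine Finset.sum_congr rfl fun i _ => ?_
    rw [← hp i, Prod.fst_sum]
    exact Finset.sum_congr rfl fun j _ => by rw [Prod.smul_fst, ← hxy]
  · calc ∑ i, f i (∑ j ∈ s i, w' ⟨i, j⟩ • x i j)
        ≤ ∑ i, (nonconvexity (s i).card (f i) +
            ((∑ j ∈ s i, w' ⟨i, j⟩ * (f i (x i j)).toReal : ℝ) : EReal)) :=
          Finset.sum_le_sum fun i _ => le_nonconvexity_add (hproper i) (s i)
            (fun j => w' ⟨i, j⟩) (x i) (fun j _ => h0 _) (hs1 i) (fun j _ => hx i j)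
      _ ≤ _ := by
          rw [Finset.sum_add_distrib, ← coe_sum_eq]
          gcongr
          rw [Prod.snd_sum]
          have h1 : ∀ i, ∑ j ∈ s i, w' ⟨i, j⟩ * (f i (x i j)).toReal =
              ∑ j, w' ⟨i, j⟩ * (f i (x i j)).toReal := fun i => hs i fun j => (f i (x i j)).toReal
          simp only [h1]
          refine hc.trans_eq (Finset.sum_congr rfl fun i _ => ?_)
          rw [← hp i, Prod.snd_sum]
          exact Finset.sum_congr rfl fun j _ => by rw [Prod.smul_snd, ← hxy, smul_eq_mul]

/-! ### Finiteness of the values and weak duality -/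

lemma exists_feasible {m n : ℕ} {N : Fin n → ℕ}
    {f : (i : Fin n) → (Fin (N i) → ℝ) → EReal} (hproper : ∀ i, IsProper (f i))
    {A : (i : Fin n) → Matrix (Fin m) (Fin (N i)) ℝ} {b : Fin m → ℝ}
    (hfeas : primalValue f A b < ⊤) :
    ∃ x : (i : Fin n) → Fin (N i) → ℝ, (∀ i, x i ∈ dom (f i)) ∧ ∑ i, A i *ᵥ x i ≤ b := by
  simp only [primalValue, iInf_lt_iff] at hfeas
  obtain ⟨x, hx, hlt⟩ := hfeas
  exact ⟨x, lt_top_of_sum_lt_top (fun i => (hproper i).1 _) hlt, hx⟩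

lemma bot_lt_primalValue {m n : ℕ} {N : Fin n → ℕ}
    {f : (i : Fin n) → (Fin (N i) → ℝ) → EReal} (hproper : ∀ i, IsProper (f i))
    (hlsc : ∀ i, LowerSemicontinuous (f i)) (hbdd : ∀ i, Bornology.IsBounded (dom (f i)))
    (A : (i : Fin n) → Matrix (Fin m) (Fin (N i)) ℝ) (b : Fin m → ℝ) :
    ⊥ < primalValue f A b := by
  choose l hl using fun i => exists_real_le (hproper i) (hlsc i) (hbdd i)
  refine (EReal.bot_lt_coe (∑ i, l i)).trans_le (le_iInf₂ fun x _ => ?_)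
  rw [coe_sum_eq]
  exact Finset.sum_le_sum fun i _ => hl i _

lemma le_dualValue {m n : ℕ} {N : Fin n → ℕ}
    {f : (i : Fin n) → (Fin (N i) → ℝ) → EReal}
    {A : (i : Fin n) → Matrix (Fin m) (Fin (N i)) ℝ} (b : Fin m → ℝ) {y : Fin m → ℝ}
    (hy : 0 ≤ y) {q : Fin n → ℝ} (hq : ∀ i, conjugate (f i) (-((A i)ᵀ *ᵥ y)) = q i) :
    ((-∑ i, q i - b ⬝ᵥ y : ℝ) : EReal) ≤ dualValue f A b := by
  refine le_trans (le_of_eq ?_) (le_iSup₂ (f := fun (y : Fin m → ℝ) (_ : y ∈ {y | 0 ≤ y}) =>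
    -(∑ i, conjugate (f i) (-((A i)ᵀ *ᵥ y))) - ((b ⬝ᵥ y : ℝ) : EReal)) y hy)
  simp only [hq, ← coe_sum_eq, EReal.coe_sub, EReal.coe_neg]

lemma neg_transpose_mulVec_dotProduct {m N : ℕ} (A : Matrix (Fin m) (Fin N) ℝ) (y : Fin m → ℝ)
    (x : Fin N → ℝ) : -(Aᵀ *ᵥ y) ⬝ᵥ x = -((A *ᵥ x) ⬝ᵥ y) := by
  rw [neg_dotProduct, Matrix.mulVec_transpose, ← Matrix.dotProduct_mulVec, dotProduct_comm]

/-- Weak duality. -/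
lemma dualValue_le_primalValue {m n : ℕ} {N : Fin n → ℕ}
    {f : (i : Fin n) → (Fin (N i) → ℝ) → EReal} (hproper : ∀ i, IsProper (f i))
    (hlsc : ∀ i, LowerSemicontinuous (f i)) (hbdd : ∀ i, Bornology.IsBounded (dom (f i)))
    (A : (i : Fin n) → Matrix (Fin m) (Fin (N i)) ℝ) (b : Fin m → ℝ) :
    dualValue f A b ≤ primalValue f A b := by
  refine iSup₂_le fun y hy => le_iInf₂ fun x hx => ?_
  by_cases hdom : ∀ i, x i ∈ dom (f i)
  · choose q hq hlub using fun i => exists_conjugate_eq_isLUB (hproper i) (hlsc i) (hbdd i)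
      (-((A i)ᵀ *ᵥ y))
    have h1 : ∑ i, f i (x i) = ((∑ i, (f i (x i)).toReal : ℝ) : EReal) := by
      rw [coe_sum_eq]
      exact Finset.sum_congr rfl fun i _ => (coe_toReal_of_mem_dom (hproper i) (hdom i)).symm
    simp only [hq, h1, ← coe_sum_eq, ← EReal.coe_neg, ← EReal.coe_sub, EReal.coe_le_coe_iff]
    have h2 : ∑ i, (-((A i *ᵥ x i) ⬝ᵥ y) - (f i (x i)).toReal) ≤ ∑ i, q i :=
      Finset.sum_le_sum fun i _ => by
        rw [← neg_transpose_mulVec_dotProduct]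
        exact (hlub i).1 ⟨x i, hdom i, rfl⟩
    rw [Finset.sum_sub_distrib, Finset.sum_neg_distrib, ← sum_dotProduct] at h2
    have h3 : (∑ i, A i *ᵥ x i) ⬝ᵥ y ≤ b ⬝ᵥ y := dotProduct_le_dotProduct_of_nonneg_right hx hy
    linarith
  · have : ¬ ∑ i, f i (x i) < ⊤ := fun h =>
      hdom (lt_top_of_sum_lt_top (fun i => (hproper i).1 _) h)
    rw [not_lt_top_iff.1 this]
    exact le_top

lemma bot_lt_dualValue {m n : ℕ} {N : Fin n → ℕ}
    {f : (i : Fin n) → (Fin (N i) → ℝ) → EReal} (hproper : ∀ i, IsProper (f i))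
    (hlsc : ∀ i, LowerSemicontinuous (f i)) (hbdd : ∀ i, Bornology.IsBounded (dom (f i)))
    (A : (i : Fin n) → Matrix (Fin m) (Fin (N i)) ℝ) (b : Fin m → ℝ) :
    ⊥ < dualValue f A b := by
  choose q hq _ using fun i => exists_conjugate_eq_isLUB (hproper i) (hlsc i) (hbdd i)
    (-((A i)ᵀ *ᵥ (0 : Fin m → ℝ)))
  exact (EReal.bot_lt_coe _).trans_le (le_dualValue b le_rfl hq)

/-! ### Separation and the convexified problem -/

open Pointwise in
/-- Strong duality for the convexified problem, in approximate form: the pair of the right-hand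
side and the dual value is a limit of points above the sum of the convexified graphs. -/
lemma exists_mem_sum_convexHull_le {m n : ℕ} {N : Fin n → ℕ}
    {f : (i : Fin n) → (Fin (N i) → ℝ) → EReal} (hproper : ∀ i, IsProper (f i))
    (hlsc : ∀ i, LowerSemicontinuous (f i)) (hbdd : ∀ i, Bornology.IsBounded (dom (f i)))
    {A : (i : Fin n) → Matrix (Fin m) (Fin (N i)) ℝ} {b : Fin m → ℝ}
    (hfeas : primalValue f A b < ⊤) {d : ℝ} (hd : dualValue f A b = d) {ε : ℝ} (hε : 0 < ε) :
    ∃ z ∈ ∑ i, convexHull ℝ ((fun x => (A i *ᵥ x, (f i x).toReal)) '' dom (f i)),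
      (∀ j, z.1 j ≤ b j + ε) ∧ z.2 ≤ d + ε := by
  set H := ∑ i, convexHull ℝ ((fun x => (A i *ᵥ x, (f i x).toReal)) '' dom (f i)) with hH
  have hmem : ∀ x : (i : Fin n) → Fin (N i) → ℝ, (∀ i, x i ∈ dom (f i)) →
      (∑ i, A i *ᵥ x i, ∑ i, (f i (x i)).toReal) ∈ H := fun x hx => by
    refine (Set.mem_fintype_sum _ _).2 ⟨fun i => (A i *ᵥ x i, (f i (x i)).toReal),
      fun i => subset_convexHull ℝ _ ⟨x i, hx i, rfl⟩, ?_⟩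
    ext <;> simp [Prod.fst_sum, Prod.snd_sum]
  have hHc : Convex ℝ H := convex_sum _ fun _ _ => convex_convexHull ℝ _
  let K : Set ((Fin m → ℝ) × ℝ) := {v | ∃ z ∈ H, z ≤ v}
  have hK : Convex ℝ K := by
    rintro v ⟨z, hz, hzv⟩ v' ⟨z', hz', hzv'⟩ s t hs ht hst
    exact ⟨_, hHc hz hz' hs ht hst,
      add_le_add (smul_le_smul_of_nonneg_left hzv hs) (smul_le_smul_of_nonneg_left hzv' ht)⟩
  by_cases hcl : (b, d) ∈ closure K
  · obtain ⟨v, ⟨z, hz, hzv⟩, hv⟩ := Metric.mem_closure_iff.1 hcl ε hε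
    rw [Prod.dist_eq, max_lt_iff] at hv
    refine ⟨z, hz, fun j => ?_, ?_⟩
    · have h1 := (dist_le_pi_dist b v.1 j).trans_lt hv.1
      rw [Real.dist_eq, abs_lt] at h1
      have h2 := hzv.1 j
      linarith [h1.1]
    · have h1 := hv.2
      rw [Real.dist_eq, abs_lt] at h1
      have h2 := hzv.2
      linarith [h1.1]
  exfalso
  obtain ⟨F, c, hF, hFK⟩ := geometric_hahn_banach_point_closed hK.closure isClosed_closure hcl
  replace hFK : ∀ z ∈ H, ∀ v, z ≤ v → c < F v := fun z hz v hv =>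
    hFK v (subset_closure ⟨z, hz, hv⟩)
  obtain ⟨x₀, hx₀, hx₀b⟩ := exists_feasible hproper hfeas
  -- Otherwise moving from a point of `H` along `e`, which stays in `K`, would bring `F` down to `c`
  -- or below.
  have hpos : ∀ e : (Fin m → ℝ) × ℝ, 0 ≤ e → 0 ≤ F e := fun e he => by
    by_contra! hneg
    set z₀ := ((∑ i, A i *ᵥ x₀ i, ∑ i, (f i (x₀ i)).toReal) : (Fin m → ℝ) × ℝ)
    have hs : 0 ≤ |c - F z₀| / -F e := div_nonneg (abs_nonneg _) (by linarith)
    have h1 := hFK z₀ (hmem x₀ hx₀) (z₀ + (|c - F z₀| / -F e) • e)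
      (le_add_of_nonneg_right (smul_nonneg hs he))
    rw [map_add, map_smul, smul_eq_mul, div_mul_eq_mul_div, div_neg,
      mul_div_cancel_right₀ _ hneg.ne] at h1
    linarith [neg_abs_le (c - F z₀), le_abs_self (c - F z₀)]
  let y : Fin m → ℝ := fun j => F (Pi.single j 1, 0)
  let τ : ℝ := F (0, 1)
  have hFeq : ∀ u t, F (u, t) = u ⬝ᵥ y + t * τ := fun u t => by
    have h1 : ((u, t) : (Fin m → ℝ) × ℝ) =
        ∑ j, u j • ((Pi.single j 1, 0) : (Fin m → ℝ) × ℝ) + t • (0, 1) := by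
      ext j
      · simp [Prod.fst_sum, Finset.sum_apply, Pi.single_apply]
      · simp [Prod.snd_sum]
    rw [h1, map_add, map_sum, map_smul]
    simp only [map_smul, smul_eq_mul]
    rfl
  have hy : 0 ≤ y := fun j => hpos _ ⟨Pi.single_nonneg.2 zero_le_one, le_rfl⟩
  -- The hyperplane is not vertical: if `τ = 0`, then `F` takes the same value at `(b, d)` as at a
  -- point of `K` above `b` supplied by feasibility.
  have hτ : 0 < τ := by
    refine lt_of_le_of_ne (hpos _ ⟨le_rfl, zero_le_one⟩) fun h => ?_
    have h1 := hFK _ (hmem x₀ hx₀) (b, ∑ i, (f i (x₀ i)).toReal) ⟨hx₀b, le_rfl⟩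
    rw [hFeq, ← h] at h1 hF
    linarith
  have hy' : 0 ≤ τ⁻¹ • y := smul_nonneg (inv_nonneg.2 hτ.le) hy
  choose q hq hlub using fun i => exists_conjugate_eq_isLUB (hproper i) (hlsc i) (hbdd i)
    (-((A i)ᵀ *ᵥ (τ⁻¹ • y)))
  have hqd := le_dualValue b hy' hq
  rw [hd, EReal.coe_le_coe_iff, dotProduct_smul, smul_eq_mul] at hqd
  rw [hFeq] at hF
  -- The separation margin, rescaled, is the amount by which the dual value at `τ⁻¹ • y` would
  -- exceed `d`. Near-maximizers with error `η / (n + 1)` in each block lose less than `η` in total,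
  -- also when `n = 0`.
  set η := (c - (b ⬝ᵥ y + d * τ)) / τ with hη
  have hη0 : 0 < η := div_pos (by linarith) hτ
  have hδ : 0 < η / (n + 1) := by positivity
  have hex : ∀ i, ∃ x ∈ dom (f i),
      q i - η / (n + 1) < -(τ⁻¹ * ((A i *ᵥ x) ⬝ᵥ y)) - (f i x).toReal := fun i => by
    obtain ⟨_, ⟨x, hx, rfl⟩, h1, -⟩ := (hlub i).exists_between (sub_lt_self (q i) hδ)
    refine ⟨x, hx, ?_⟩
    simpa only [neg_transpose_mulVec_dotProduct, dotProduct_smul, smul_eq_mul] using h1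
  choose x hx hqx using hex
  have h1 := hFK _ (hmem x hx) _ le_rfl
  rw [hFeq] at h1
  have h2 := Finset.sum_le_sum fun i (_ : i ∈ Finset.univ) => (hqx i).le
  rw [Finset.sum_sub_distrib, Finset.sum_sub_distrib, Finset.sum_neg_distrib, ← Finset.mul_sum,
    ← sum_dotProduct, Finset.sum_const, Finset.card_univ, Fintype.card_fin, nsmul_eq_mul] at h2
  have h3 : (n : ℝ) * (η / (n + 1)) < η := by
    rw [mul_div_assoc', div_lt_iff₀ (by positivity)]
    linarith
  have h4 : τ * (τ⁻¹ * (b ⬝ᵥ y)) = b ⬝ᵥ y := mul_inv_cancel_left₀ hτ.ne' _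
  have h5 : τ * (τ⁻¹ * ((∑ i, A i *ᵥ x i) ⬝ᵥ y)) = (∑ i, A i *ᵥ x i) ⬝ᵥ y :=
    mul_inv_cancel_left₀ hτ.ne' _
  have h6 : τ * η = c - (b ⬝ᵥ y + d * τ) := mul_div_cancel₀ _ hτ.ne'
  have h7 : 0 < τ * (τ⁻¹ * ((∑ i, A i *ᵥ x i) ⬝ᵥ y) + ∑ i, (f i (x i)).toReal
      - τ⁻¹ * (b ⬝ᵥ y) - d - η) := by
    linear_combination h1 + h4 - h5 + h6
  have h8 := (mul_pos_iff_of_pos_left hτ).1 h7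
  linarith

/-! ### Passage to the limit and the gap bound -/

open Filter Topology in
/-- If the relaxations of the constraint by every `ε > 0` admit points with objective value at
most `c` in a fixed bounded set, then `c` bounds the primal value from above. -/
lemma primalValue_le_of_forall_pos {m n : ℕ} {N : Fin n → ℕ}
    {f : (i : Fin n) → (Fin (N i) → ℝ) → EReal} (hproper : ∀ i, IsProper (f i))
    (hlsc : ∀ i, LowerSemicontinuous (f i))
    {A : (i : Fin n) → Matrix (Fin m) (Fin (N i)) ℝ} {b : Fin m → ℝ}
    {S : (i : Fin n) → Set (Fin (N i) → ℝ)} (hS : ∀ i, Bornology.IsBounded (S i)) {c : EReal}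
    {ε₀ : ℝ} (hε₀ : 0 < ε₀)
    (h : ∀ ε : ℝ, 0 < ε → ε < ε₀ → ∃ x : (i : Fin n) → Fin (N i) → ℝ, (∀ i, x i ∈ S i) ∧
      (∀ j, (∑ i, A i *ᵥ x i) j ≤ b j + ε) ∧ ∑ i, f i (x i) ≤ c) :
    primalValue f A b ≤ c := by
  obtain ⟨e, -, he, hlim⟩ := exists_seq_strictAnti_tendsto' hε₀
  choose x hxS hxA hxc using fun s => h (e s) (he s).1 (he s).2
  have hcpt : IsCompact (Set.univ.pi fun i => closure (S i)) :=
    isCompact_univ_pi fun i => (hS i).isCompact_closure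
  obtain ⟨a, -, φ, hφ, ha⟩ := hcpt.tendsto_subseq
    (fun s => Set.mem_univ_pi.2 fun i => subset_closure (hxS s i))
  have hcont : Continuous fun x : (i : Fin n) → Fin (N i) → ℝ => ∑ i, A i *ᵥ x i :=
    continuous_finsetSum _ fun i _ =>
      Continuous.matrix_mulVec continuous_const (continuous_apply i)
  have haA : ∑ i, A i *ᵥ a i ≤ b := fun j => by
    have h1 := ((continuous_apply j).comp hcont).continuousAt.tendsto.comp ha
    have h2 : Tendsto (fun s => b j + e (φ s)) atTop (𝓝 (b j + 0)) :=
      (hlim.comp hφ.tendsto_atTop).const_add _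
    rw [add_zero] at h2
    exact le_of_tendsto_of_tendsto' h1 h2 fun s => hxA (φ s) j
  refine (iInf₂_le a haA).trans ?_
  have hl : LowerSemicontinuous fun x : (i : Fin n) → Fin (N i) → ℝ => ∑ i, f i (x i) :=
    lowerSemicontinuous_finset_sum (fun i _ => (hproper i).1 _)
      (fun i => (hlsc i).comp (continuous_apply i)) _
  -- By lower semicontinuity, an objective value above `c` at the limit would persist along the
  -- subsequence.
  by_contra! hlt
  obtain ⟨s, hs⟩ := (ha.eventually (hl a c hlt)).exists
  exact absurd (hxc (φ s)) (not_le.2 hs)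

end SeparableDuality

theorem theorem3 {m n : ℕ} (N : Fin n → ℕ)
    (f : (i : Fin n) → (Fin (N i) → ℝ) → EReal)
    (A : (i : Fin n) → Matrix (Fin m) (Fin (N i)) ℝ) (b : Fin m → ℝ)
    (hproper : ∀ i, SeparableDuality.IsProper (f i))
    (hlsc : ∀ i, LowerSemicontinuous (f i))
    (hbdd : ∀ i, Bornology.IsBounded (SeparableDuality.dom (f i)))
    (hfeas : SeparableDuality.primalValue f A b < ⊤) :
    (⊥ < SeparableDuality.primalValue f A b ∧
      ⊥ < SeparableDuality.dualValue f A b ∧ SeparableDuality.dualValue f A b < ⊤) ∧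
    ∃ k : Fin n → ℕ, (∀ i, 1 ≤ k i ∧ k i ≤ m + 1) ∧ ∑ i, k i ≤ m + n ∧
      SeparableDuality.primalValue f A b - SeparableDuality.dualValue f A b
        ≤ ∑ i, SeparableDuality.nonconvexity (k i) (f i) := by
  open SeparableDuality in
  have hdbot := bot_lt_dualValue hproper hlsc hbdd A b
  have hdtop := (dualValue_le_primalValue hproper hlsc hbdd A b).trans_lt hfeas
  refine ⟨⟨bot_lt_primalValue hproper hlsc hbdd A b, hdbot, hdtop⟩, ?_⟩
  obtain ⟨d, hd⟩ : ∃ d : ℝ, dualValue f A b = d :=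
    ⟨_, (EReal.coe_toReal hdtop.ne hdbot.ne').symm⟩
  -- The numbers of points found by the reduction depend on `ε`. Since only finitely many choices
  -- are admissible, one that maximizes the bound serves for every `ε`.
  let T : Finset (Fin n → ℕ) :=
    (Fintype.piFinset fun _ => Finset.Icc 1 (m + 1)).filter fun k => ∑ i, k i ≤ m + n
  have hT : ∀ k, k ∈ T ↔ (∀ i, 1 ≤ k i ∧ k i ≤ m + 1) ∧ ∑ i, k i ≤ m + n := fun k => by
    simp [T]
  obtain ⟨k, hkT, hkmax⟩ := T.exists_max_image (fun k => ∑ i, nonconvexity (k i) (f i))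
    ⟨fun _ => 1, (hT _).2 ⟨fun _ => ⟨le_rfl, by omega⟩, by simp⟩⟩
  refine ⟨k, ((hT k).1 hkT).1, ((hT k).1 hkT).2, EReal.sub_le_of_le_add ?_⟩
  set R := ∑ i, nonconvexity (k i) (f i)
  rw [hd]
  by_contra! hlt
  -- Two reals are inserted so that the gap `c - c'` absorbs the error `ε`.
  obtain ⟨c, hRc, hcp⟩ := EReal.lt_iff_exists_real_btwn.1 hlt
  obtain ⟨c', hRc', hcc'⟩ := EReal.lt_iff_exists_real_btwn.1 hRc
  rw [EReal.coe_lt_coe_iff] at hcc'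
  refine absurd (primalValue_le_of_forall_pos hproper hlsc
    (fun i => isBounded_convexHull.2 (hbdd i)) (sub_pos.2 hcc') (c := (c : EReal))
    fun ε hε hεc => ?_) (not_le.2 hcp)
  obtain ⟨z, hz, hzb, hzd⟩ := exists_mem_sum_convexHull_le hproper hlsc hbdd hfeas hd hε
  obtain ⟨k', hk', hk's, x, hx, hxz, hfx⟩ := exists_of_mem_sum_convexHull hproper A hz
  refine ⟨x, hx, fun j => hxz ▸ hzb j, hfx.trans ?_⟩
  calc ∑ i, nonconvexity (k' i) (f i) + (z.2 : EReal)
      ≤ R + ((d + ε : ℝ) : EReal) :=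
        add_le_add (hkmax k' ((hT k').2 ⟨hk', hk's⟩)) (EReal.coe_le_coe_iff.2 hzd)
    _ = (R + d) + (ε : EReal) := by rw [EReal.coe_add, add_assoc]
    _ ≤ (c' : EReal) + ε := add_le_add_left hRc'.le _
    _ ≤ c := by
        rw [← EReal.coe_add, EReal.coe_le_coe_iff]
        linarith
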